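/- Let $S_3$ be the metric space that consists of three half-lines $b_1, b_2, b_3$, each a copy of $[0,\infty)$, glued together at their common origin $O$. A point of $S_3$ is written $(x, b_\ell)$, where $x \ge 0$ is its distance to $O$ and $b_\ell$ is the half-line it lies on (so $(0,b_1)=(0,b_2)=(0,b_3)=O$). The distance of $(x,b_\ell)$ and $(x',b_{\ell'})$ is $|x-x'|$ if $\ell=\ell'$, and $x+x'$ otherwise. A deterministic mechanism for 2-Facility Location with $n$ agents in $S_3$ is a function $F$ that maps every instance $\vec{x} = (x_1,\dots,x_n) \in S_3^n$ to a pair $F(\vec{x}) \in S_3^2$ of facility locations. For a pair $y = (y_1,y_2) \in S_3^2$, the cost of an agent at $a \in S_3$ is $\mathrm{cost}[a,y] = \min\{d(a,y_1), d(a,y_2)\}$, the social cost is $\mathrm{cost}[\vec{x},y] = \sum_{i=1}^n \mathrm{cost}[x_i,y]$, and the optimal cost for $\vec{x}$ is $\mathrm{opt}(\vec{x}) = \min_{y \in S_3^2} \mathrm{cost}[\vec{x},y]$. The mechanism $F$ is strategyproof if $\mathrm{cost}[x_i,F(\vec{x})] \le \mathrm{cost}[x_i,F(\vec{x}_{-i},y)]$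 for all instances $\vec{x}$, all agents $i$ and all locations $y \in S_3$, where $(\vec{x}_{-i},y)$ is $\vec{x}$ with $x_i$ replaced by $y$. It has an approximation ratio of $\rho \ge 1$ if $\mathrm{cost}[\vec{x},F(\vec{x})] \le \rho \cdot \mathrm{opt}(\vec{x})$ for all instances $\vec{x}$. Then for every $n \ge 3$, every deterministic strategyproof mechanism for 2-Facility Location with $n$ agents in $S_3$ has an unbounded approximation ratio: there is no real number $\rho \ge 1$ (which may depend on $n$ and on the mechanism) such that the mechanism has an approximation ratio of $\rho$. -/

import Mathlib

open scoped NNReal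

namespace FacilityLocation

/-- Coordinates `(x, b_ℓ)` of a point of the star: its distance `x ≥ 0` from the center and the
branch `ℓ` it lies on. The three coordinates `(0, b_ℓ)` all describe the center. -/
@[ext]
structure StarCoord where
  radius : ℝ≥0
  branch : Fin 3

/-- `|x - x'|` on a common branch and `x + x'` on different branches. -/
noncomputable def StarCoord.starDist (p q : StarCoord) : ℝ :=
  if p.branch = q.branch then |(p.radius : ℝ) - q.radius| else (p.radius : ℝ) + q.radius

theorem StarCoord.starDist_self (p : StarCoord) : p.starDist p = 0 := by
  simp [starDist]

theorem StarCoord.starDist_comm (p q : StarCoord) : p.starDist q = q.starDist p := by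
  unfold starDist
  by_cases h : p.branch = q.branch
  · rw [if_pos h, if_pos h.symm, abs_sub_comm]
  · rw [if_neg h, if_neg (Ne.symm h), add_comm]

theorem StarCoord.starDist_triangle (p q r : StarCoord) :
    p.starDist r ≤ p.starDist q + q.starDist r := by
  have hp : (0 : ℝ) ≤ p.radius := p.radius.coe_nonneg
  have hq : (0 : ℝ) ≤ q.radius := q.radius.coe_nonneg
  have hr : (0 : ℝ) ≤ r.radius := r.radius.coe_nonneg
  unfold starDist
  split_ifs <;> first
    | (exfalso; simp_all; done)
    | (rcases abs_cases ((p.radius : ℝ) - q.radius) with h1 | h1 <;>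
       rcases abs_cases ((q.radius : ℝ) - r.radius) with h2 | h2 <;>
       rcases abs_cases ((p.radius : ℝ) - r.radius) with h3 | h3 <;>
       linarith)

noncomputable instance : PseudoMetricSpace StarCoord where
  dist := StarCoord.starDist
  dist_self := StarCoord.starDist_self
  dist_comm := StarCoord.starDist_comm
  dist_triangle := StarCoord.starDist_triangle

/-- The star `S₃`: three half-lines `[0, ∞)` with a common origin. It is the space of coordinates
`(x, b_ℓ)` in which coordinates at distance `0`, that is, the three descriptions of the center,
are identified. -/
abbrev S₃ : Type := SeparationQuotient StarCoord

/-- The point of `S₃` at distance `x` from the center on the branch `ℓ`. -/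
noncomputable def S₃.point (x : ℝ≥0) (ℓ : Fin 3) : S₃ := SeparationQuotient.mk ⟨x, ℓ⟩

theorem S₃.dist_point (x x' : ℝ≥0) (ℓ ℓ' : Fin 3) :
    dist (S₃.point x ℓ) (S₃.point x' ℓ') =
      if ℓ = ℓ' then |(x : ℝ) - x'| else (x : ℝ) + x' := rfl

/-- A deterministic mechanism for 2-Facility Location with `n` agents in `X`: it maps each
instance (the tuple of the reported locations) to the locations of two facilities. -/
abbrev Mechanism (n : ℕ) (X : Type*) : Type _ := (Fin n → X) → X × X

section Costs

variable {n : ℕ} {X : Type*} [MetricSpace X]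

/-- The cost of an agent at `a` when the facilities are at `y.1` and `y.2`: the distance of `a` to
the nearest facility. -/
noncomputable def agentCost (a : X) (y : X × X) : ℝ := min (dist a y.1) (dist a y.2)

/-- The social cost: the sum of the costs of the agents. -/
noncomputable def socialCost (x : Fin n → X) (y : X × X) : ℝ := ∑ i, agentCost (x i) y

/-- The optimal cost of an instance. -/
noncomputable def optCost (x : Fin n → X) : ℝ := ⨅ y : X × X, socialCost x y

/-- No agent `i` can decrease her cost by reporting a location `y` instead of her location. -/
def Mechanism.IsStrategyproof (F : Mechanism n X) : Prop :=
  ∀ (x : Fin n → X) (i : Fin n) (y : X),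
    agentCost (x i) (F x) ≤ agentCost (x i) (F (Function.update x i y))

/-- `F` has an approximation ratio of `ρ`. -/
def Mechanism.HasApproxRatio (F : Mechanism n X) (ρ : ℝ) : Prop :=
  1 ≤ ρ ∧ ∀ x : Fin n → X, socialCost x (F x) ≤ ρ * optCost x

/-- `F` has a bounded approximation ratio. The number `n` of agents is fixed here, so `ρ` may
depend on it in any way. -/
def Mechanism.HasBoundedApproxRatio (F : Mechanism n X) : Prop :=
  ∃ ρ : ℝ, F.HasApproxRatio ρ

end Costs

end FacilityLocation

/-! Letting one agent report for all but two of the agents leaves a strategyproof mechanism for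
three agents, and a bounded ratio then bounds every cost by a constant times each pairwise distance.

When one agent is far from the other two, these two share a facility. On a single branch it could
simply follow whichever of them is farther out. The far agent leaves two branches free, however, and
that rule across both would make the facility jump (`not_isServedNear_both`). Together with
`not_hasHole_both` this forces one of the two close agents to dictate the facility near the center,
and the same one on both branches (`favorsSecond_or_swap`).

If j dictates over k while i is far, then j dictates over i while k is far (`favorsSecond_rev`);
otherwise some instance would need three facilities. So each agent dictates in both of her pairs or
in neither, which makes the number of dictatorships even. But three pairs have three dictators. -/

namespace FacilityLocation

/-! ### Facilities and costs -/

/-- `y` is one of the two facility locations of `p`. -/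
def IsFacility {X : Type*} (y : X) (p : X × X) : Prop := y = p.1 ∨ y = p.2

theorem IsFacility.eq_or_eq_or_eq {X : Type*} {y z w : X} {p : X × X} (hy : IsFacility y p)
    (hz : IsFacility z p) (hw : IsFacility w p) : y = z ∨ y = w ∨ z = w := by
  unfold IsFacility at *
  grind

section Facilities

variable {X : Type*} [MetricSpace X]

theorem agentCost_le_dist {y : X} {p : X × X} (h : IsFacility y p) (a : X) :
    agentCost a p ≤ dist a y := by
  rcases h with rfl | rfl
  · exact min_le_left _ _
  · exact min_le_right _ _

theorem exists_isFacility_agentCost_eq (a : X) (p : X × X) :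
    ∃ y, IsFacility y p ∧ agentCost a p = dist a y := by
  rcases min_choice (dist a p.1) (dist a p.2) with h | h
  · exact ⟨p.1, Or.inl rfl, h⟩
  · exact ⟨p.2, Or.inr rfl, h⟩

theorem agentCost_nonneg (a : X) (p : X × X) : 0 ≤ agentCost a p :=
  le_min dist_nonneg dist_nonneg

theorem isFacility_of_agentCost_nonpos {a : X} {p : X × X} (h : agentCost a p ≤ 0) :
    IsFacility a p := by
  obtain ⟨y, hy, he⟩ := exists_isFacility_agentCost_eq a p
  have : a = y := dist_le_zero.1 (he ▸ h)
  exact this ▸ hy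

theorem agentCost_eq_zero {a : X} {p : X × X} (h : IsFacility a p) : agentCost a p = 0 :=
  le_antisymm (by simpa using agentCost_le_dist h a) (agentCost_nonneg _ _)

/-- A strategyproof mechanism for three agents in which every agent's cost is at most `ρ` times
every pairwise distance. -/
structure IsNice (ρ : ℝ) (M : X → X → X → X × X) : Prop where
  one_le : 1 ≤ ρ
  sp₁ : ∀ a b c a', agentCost a (M a b c) ≤ agentCost a (M a' b c)
  sp₂ : ∀ a b c b', agentCost b (M a b c) ≤ agentCost b (M a b' c)
  sp₃ : ∀ a b c c', agentCost c (M a b c) ≤ agentCost c (M a b c')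
  bound₁₂ : ∀ a b c d, d = a ∨ d = b ∨ d = c → agentCost d (M a b c) ≤ ρ * dist a b
  bound₁₃ : ∀ a b c d, d = a ∨ d = b ∨ d = c → agentCost d (M a b c) ≤ ρ * dist a c
  bound₂₃ : ∀ a b c d, d = a ∨ d = b ∨ d = c → agentCost d (M a b c) ≤ ρ * dist b c

/-- Exchange the second and the third agent. -/
def swapAgents (M : X → X → X → X × X) : X → X → X → X × X := fun a b c => M a c b

/-- Exchange the first and the third agent. -/
def revAgents (M : X → X → X → X × X) : X → X → X → X × X := fun a b c => M c b a

variable {ρ : ℝ} {M : X → X → X → X × X}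

theorem IsNice.swap (hM : IsNice ρ M) : IsNice ρ (swapAgents M) where
  one_le := hM.one_le
  sp₁ a b c a' := hM.sp₁ a c b a'
  sp₂ a b c b' := hM.sp₃ a c b b'
  sp₃ a b c c' := hM.sp₂ a c b c'
  bound₁₂ a b c d hd := hM.bound₁₃ a c b d (by tauto)
  bound₁₃ a b c d hd := hM.bound₁₂ a c b d (by tauto)
  bound₂₃ a b c d hd := dist_comm b c ▸ hM.bound₂₃ a c b d (by tauto)

theorem IsNice.rev (hM : IsNice ρ M) : IsNice ρ (revAgents M) where
  one_le := hM.one_le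
  sp₁ a b c a' := hM.sp₃ c b a a'
  sp₂ a b c b' := hM.sp₂ c b a b'
  sp₃ a b c c' := hM.sp₁ c b a c'
  bound₁₂ a b c d hd := dist_comm a b ▸ hM.bound₂₃ c b a d (by tauto)
  bound₁₃ a b c d hd := dist_comm a c ▸ hM.bound₁₃ c b a d (by tauto)
  bound₂₃ a b c d hd := dist_comm b c ▸ hM.bound₁₂ c b a d (by tauto)

theorem IsNice.cost₁_le (hM : IsNice ρ M) {y a' b c : X} (h : IsFacility y (M a' b c)) (a : X) :
    agentCost a (M a b c) ≤ dist a y :=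
  (hM.sp₁ a b c a').trans (agentCost_le_dist h a)

theorem IsNice.cost₂_le (hM : IsNice ρ M) {y a b' c : X} (h : IsFacility y (M a b' c)) (b : X) :
    agentCost b (M a b c) ≤ dist b y :=
  (hM.sp₂ a b c b').trans (agentCost_le_dist h b)

theorem IsNice.cost₃_le (hM : IsNice ρ M) {y a b c' : X} (h : IsFacility y (M a b c')) (c : X) :
    agentCost c (M a b c) ≤ dist c y :=
  (hM.sp₃ a b c c').trans (agentCost_le_dist h c)

theorem IsNice.isFacility_of_eq (hM : IsNice ρ M) (a b : X) : IsFacility b (M a b b) :=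
  isFacility_of_agentCost_nonpos (by simpa using hM.bound₂₃ a b b b (by simp))

/-- Two agents that are much closer to each other than to the first agent are served by the same
facility, which is not farther from them than they are from each other. -/
theorem IsNice.exists_common_facility (hM : IsNice ρ M) {a b c : X}
    (hb : 2 * ρ * dist b c < dist a b) (hc : 2 * ρ * dist b c < dist a c) :
    ∃ y, IsFacility y (M a b c) ∧ agentCost b (M a b c) = dist b y ∧
      agentCost c (M a b c) = dist c y ∧ dist b y ≤ dist b c ∧ dist c y ≤ dist b c := by
  obtain ⟨u, hu, hau⟩ := exists_isFacility_agentCost_eq a (M a b c)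
  obtain ⟨v, hv, hbv⟩ := exists_isFacility_agentCost_eq b (M a b c)
  obtain ⟨w, hw, hcw⟩ := exists_isFacility_agentCost_eq c (M a b c)
  have h1 := hM.bound₂₃ a b c a (by simp)
  have h2 := hM.bound₂₃ a b c b (by simp)
  have h3 := hM.bound₂₃ a b c c (by simp)
  have h4 := hM.cost₂_le (hM.isFacility_of_eq a c) b
  have h5 := hM.cost₃_le (hM.isFacility_of_eq a b) c
  rw [dist_comm c b] at h5
  -- Two facilities serve three agents. If the first agent shared hers, the triangle inequality
  -- would put her within `2 * ρ * dist b c` of another agent.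
  rcases hu.eq_or_eq_or_eq hv hw with rfl | rfl | rfl
  · have := dist_triangle_right a b u
    linarith
  · have := dist_triangle_right a c u
    linarith
  · exact ⟨v, hv, hbv, hcw, hbv ▸ h4, hcw ▸ h5⟩

end Facilities

/-! ### Rays of the star -/

/-- The point at distance `t` from the center on the branch `γ`. -/
noncomputable def ray (γ : Fin 3) (t : ℝ) : S₃ := S₃.point t.toNNReal γ

theorem dist_ray_same (γ : Fin 3) {s t : ℝ} (hs : 0 ≤ s) (ht : 0 ≤ t) :
    dist (ray γ s) (ray γ t) = |s - t| := by
  rw [ray, ray, S₃.dist_point, if_pos rfl, Real.coe_toNNReal _ hs, Real.coe_toNNReal _ ht]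

theorem dist_ray_ne {γ γ' : Fin 3} (h : γ ≠ γ') {s t : ℝ} (hs : 0 ≤ s) (ht : 0 ≤ t) :
    dist (ray γ s) (ray γ' t) = s + t := by
  rw [ray, ray, S₃.dist_point, if_neg h, Real.coe_toNNReal _ hs, Real.coe_toNNReal _ ht]

theorem exists_ray (y : S₃) : ∃ γ t, 0 ≤ t ∧ y = ray γ t := by
  obtain ⟨⟨r, γ⟩, rfl⟩ := SeparationQuotient.surjective_mk y
  exact ⟨γ, r, r.coe_nonneg, by simp [ray, S₃.point]⟩

theorem ray_zero (γ γ' : Fin 3) : ray γ 0 = ray γ' 0 := by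
  by_cases h : γ = γ'
  · rw [h]
  · rw [← dist_eq_zero, dist_ray_ne h le_rfl le_rfl, add_zero]

theorem eq_ray_of_dist_lt {γ : Fin 3} {w : ℝ} {y : S₃} (h : dist (ray γ w) y < w) :
    ∃ t, 0 < t ∧ y = ray γ t ∧ |w - t| = dist (ray γ w) y := by
  have hw : 0 ≤ w := dist_nonneg.trans h.le
  obtain ⟨γ', t, ht, rfl⟩ := exists_ray y
  by_cases hγ : γ = γ'
  · subst hγ
    have e := dist_ray_same γ hw ht
    refine ⟨t, ?_, rfl, e.symm⟩
    rw [e] at h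
    have := le_abs_self (w - t)
    linarith
  · rw [dist_ray_ne hγ hw ht] at h
    linarith

theorem eq_ray_of_dist_le {γ : Fin 3} {a b : ℝ} {y : S₃} (ha : 0 ≤ a) (hab : a ≤ b)
    (h₁ : dist (ray γ b) y ≤ b - a) (h₂ : dist (ray γ a) y ≤ b - a) :
    ∃ t, a ≤ t ∧ t ≤ b ∧ y = ray γ t := by
  obtain ⟨γ', t, ht, rfl⟩ := exists_ray y
  by_cases hγ : γ = γ'
  · subst hγ
    rw [dist_ray_same γ (ha.trans hab) ht] at h₁
    rw [dist_ray_same γ ha ht] at h₂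
    have := abs_le.1 h₁
    have := abs_le.1 h₂
    exact ⟨t, by linarith, by linarith, rfl⟩
  · rw [dist_ray_ne hγ (ha.trans hab) ht] at h₁
    -- Off the branch only the center remains possible, and only when `a = 0`.
    have h0 : t = 0 := by linarith
    have h1 : a = 0 := by linarith
    exact ⟨0, h1.le, ha.trans hab, by rw [h0]; exact ray_zero _ _⟩

/-! ### Zero sets of cost functions on an interval -/

/-- Zeros of `c` stand for served locations. A gap between zeros cannot occur: inside it the cost is
the distance to a zero on the left, yet near its right end a zero on the right is closer. -/
theorem eq_zero_of_forall_exists_left {c : ℝ → ℝ} {a q : ℝ}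
    (hc : ∀ t, a ≤ t → t ≤ q → ∃ s, a ≤ s ∧ s ≤ t ∧ c t = t - s ∧ c s = 0)
    (hz : ∀ s t, a ≤ s → s ≤ q → a ≤ t → t ≤ q → c s = 0 → c t ≤ |t - s|)
    (hq : c q = 0) {t : ℝ} (hat : a ≤ t) (htq : t ≤ q) : c t = 0 := by
  obtain ⟨s₀, has₀, hs₀t, hct, hcs₀⟩ := hc t hat htq
  by_contra hne
  have hlt : s₀ < t := lt_of_le_of_ne hs₀t (fun h => hne (by rw [hct, h, sub_self]))
  set Z : Set ℝ := {z | t ≤ z ∧ z ≤ q ∧ c z = 0} with hZ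
  have hZb : BddBelow Z := ⟨t, fun z hz => hz.1⟩
  have hZn : Z.Nonempty := ⟨q, htq, le_rfl, hq⟩
  set r := sInf Z with hr
  have htr : t ≤ r := le_csInf hZn fun z hz => hz.1
  -- The infimum `r` need not be a zero. The slack `t - s₀` still makes the midpoint of `t` and `r`
  -- nearer to `z` than to `s₀`.
  obtain ⟨z, ⟨hz1, hz2, hz3⟩, hzr⟩ := exists_lt_of_csInf_lt hZn (show sInf Z < r + (t - s₀) by linarith)
  have hrz : r ≤ z := csInf_le hZb ⟨hz1, hz2, hz3⟩
  obtain ⟨s, has, hsu, hcu, hcs⟩ := hc ((t + r) / 2) (by linarith) (by linarith)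
  have hst : s < t := by
    by_contra hst
    push Not at hst
    have : r ≤ s := csInf_le hZb ⟨hst, by linarith, hcs⟩
    have hsr : s = t := by linarith
    exact hne (hsr ▸ hcs)
  have h1 := hz s t has (by linarith) hat htq hcs
  rw [abs_of_pos (by linarith)] at h1
  have h2 := hz z ((t + r) / 2) (by linarith) hz2 (by linarith) (by linarith) hz3
  rw [abs_of_nonpos (by linarith)] at h2
  linarith

theorem eq_zero_of_forall_exists_right {c : ℝ → ℝ} {p b : ℝ}
    (hc : ∀ t, p ≤ t → t ≤ b → ∃ s, t ≤ s ∧ s ≤ b ∧ c t = s - t ∧ c s = 0)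
    (hz : ∀ s t, p ≤ s → s ≤ b → p ≤ t → t ≤ b → c s = 0 → c t ≤ |t - s|)
    (hp : c p = 0) {t : ℝ} (hpt : p ≤ t) (htb : t ≤ b) : c t = 0 := by
  have := eq_zero_of_forall_exists_left (c := fun t => c (-t)) (a := -b) (q := -p) (t := -t)
    (fun t h1 h2 => by
      obtain ⟨s, h3, h4, h5, h6⟩ := hc (-t) (by linarith) (by linarith)
      exact ⟨-s, by linarith, by linarith, by simp only [h5]; ring, by simpa using h6⟩)
    (fun s t h1 h2 h3 h4 h5 => by
      have := hz (-s) (-t) (by linarith) (by linarith) (by linarith) (by linarith) h5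
      rwa [← abs_neg, show -(-t - -s) = t - s by ring] at this)
    (by simpa using hp) (by linarith) (by linarith)
  simpa using this

/-! ### Mechanisms with the first agent far away -/

section FarAgent

variable {ρ : ℝ} {M : S₃ → S₃ → S₃ → S₃ × S₃} {h : ℝ} {β γ : Fin 3}

/-- The first agent is at distance `h` on the branch `β` and the third agent at distance `a` on the
branch `γ`. The second agent, at distance `b ≥ a` on `γ`, is served at the location of the third
agent as long as `b` is not too large. -/
def HasHole (ρ : ℝ) (M : S₃ → S₃ → S₃ → S₃ × S₃) (h : ℝ) (β γ : Fin 3) (a : ℝ) : Prop :=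
  ∀ b, a ≤ b → 2 * ρ * (b - a) < h + a →
    agentCost (ray γ b) (M (ray β h) (ray γ b) (ray γ a)) = b - a

/-- With the same locations, the second agent is served at her own location when `b ≥ a` is close
to `a`. -/
def IsServedNear (M : S₃ → S₃ → S₃ → S₃ × S₃) (h : ℝ) (β γ : Fin 3) (a : ℝ) : Prop :=
  ∃ δ > 0, ∀ b, a ≤ b → b ≤ a + δ →
    agentCost (ray γ b) (M (ray β h) (ray γ b) (ray γ a)) = 0

theorem IsNice.exists_facility_mem_segment (hM : IsNice ρ M) (hβγ : β ≠ γ) {a b : ℝ} (hh : 0 < h)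
    (ha : 0 ≤ a) (hab : a ≤ b) (hloc : 2 * ρ * (b - a) < h + a) :
    ∃ t, a ≤ t ∧ t ≤ b ∧ IsFacility (ray γ t) (M (ray β h) (ray γ b) (ray γ a)) ∧
      agentCost (ray γ b) (M (ray β h) (ray γ b) (ray γ a)) = b - t ∧
      agentCost (ray γ a) (M (ray β h) (ray γ b) (ray γ a)) = t - a := by
  have hb : 0 ≤ b := ha.trans hab
  have hd : dist (ray γ b) (ray γ a) = b - a := by
    rw [dist_ray_same γ hb ha, abs_of_nonneg (by linarith)]
  obtain ⟨y, hy, e1, e2, l1, l2⟩ := hM.exists_common_facility (a := ray β h) (b := ray γ b)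
    (c := ray γ a) (by rw [hd, dist_ray_ne hβγ hh.le hb]; linarith)
    (by rw [hd, dist_ray_ne hβγ hh.le ha]; linarith)
  rw [hd] at l1 l2
  obtain ⟨t, hat, htb, rfl⟩ := eq_ray_of_dist_le ha hab l1 l2
  refine ⟨t, hat, htb, hy, ?_, ?_⟩
  · rw [e1, dist_ray_same γ hb (ha.trans hat), abs_of_nonneg (by linarith)]
  · rw [e2, dist_ray_same γ ha (ha.trans hat), abs_of_nonpos (by linarith)]
    ring

/-- A failing hole provides a served location beyond `a`, and served locations have no gaps between
`a` and it. -/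
theorem IsNice.isServedNear_of_not_hasHole (hM : IsNice ρ M) (hβγ : β ≠ γ) {a : ℝ} (hh : 0 < h)
    (ha : 0 ≤ a) (hole : ¬ HasHole ρ M h β γ a) : IsServedNear M h β γ a := by
  have hρ := hM.one_le
  unfold HasHole at hole
  push Not at hole
  obtain ⟨b, hab, hloc, hne⟩ := hole
  have hloc' : ∀ t, t ≤ b → 2 * ρ * (t - a) < h + a := fun t ht => by nlinarith
  obtain ⟨s, has, hsb, hfac, hcost, -⟩ := hM.exists_facility_mem_segment hβγ hh ha hab hloc
  have hs : a < s := lt_of_le_of_ne has (by rintro rfl; exact hne hcost)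
  refine ⟨s - a, by linarith, fun t hat hts => ?_⟩
  refine eq_zero_of_forall_exists_left (a := a) (q := s)
    (c := fun t => agentCost (ray γ t) (M (ray β h) (ray γ t) (ray γ a))) ?_ ?_ ?_ hat (by linarith)
  · intro t hat hts
    obtain ⟨r, h1, h2, h3, h4, -⟩ := hM.exists_facility_mem_segment hβγ hh ha hat
      (hloc' t (hts.trans hsb))
    refine ⟨r, h1, h2, h4, le_antisymm ?_ (agentCost_nonneg _ _)⟩
    simpa using hM.cost₂_le h3 (ray γ r)
  · intro r t har _ hat _ hr
    have := hM.cost₂_le (isFacility_of_agentCost_nonpos hr.le) (ray γ t)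
    rwa [dist_ray_same γ (ha.trans hat) (ha.trans har)] at this
  · exact le_antisymm (by simpa using hM.cost₂_le hfac (ray γ s)) (agentCost_nonneg _ _)

/-- Otherwise place the second agent at a served `b` just beyond `a'`. The third agent is served at
`a` because of the hole there, hence also at `a'`, as her served locations have no gaps. The shared
facility would then lie at both `a'` and `b`. -/
theorem IsNice.hasHole_of_hasHole_of_close (hM : IsNice ρ M) (hβγ : β ≠ γ) {a a' : ℝ} (hh : 0 < h)
    (ha : 0 ≤ a) (haa' : a ≤ a') (hloc : 2 * ρ * (a' - a) < h + a) (hole : HasHole ρ M h β γ a) :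
    HasHole ρ M h β γ a' := by
  have hρ := hM.one_le
  by_contra hnot
  obtain ⟨δ, hδ, hserved⟩ := hM.isServedNear_of_not_hasHole hβγ hh (ha.trans haa') hnot
  obtain ⟨b, hb1, hb2, hb3⟩ : ∃ b, a' < b ∧ b ≤ a' + δ ∧ 2 * ρ * (b - a) < h + a := by
    have hpos : 0 < (h + a - 2 * ρ * (a' - a)) / (4 * ρ) := by
      apply div_pos <;> linarith
    refine ⟨a' + min δ ((h + a - 2 * ρ * (a' - a)) / (4 * ρ)),
      lt_add_of_pos_right _ (lt_min hδ hpos), by gcongr; exact min_le_left _ _, ?_⟩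
    have hle := min_le_right δ ((h + a - 2 * ρ * (a' - a)) / (4 * ρ))
    rw [le_div_iff₀ (by linarith)] at hle
    nlinarith
  have key : ∀ t, a ≤ t → t ≤ b → ∃ s, t ≤ s ∧ s ≤ b ∧
      IsFacility (ray γ s) (M (ray β h) (ray γ b) (ray γ t)) ∧
      agentCost (ray γ b) (M (ray β h) (ray γ b) (ray γ t)) = b - s ∧
      agentCost (ray γ t) (M (ray β h) (ray γ b) (ray γ t)) = s - t := fun t hat htb =>
    hM.exists_facility_mem_segment hβγ hh (ha.trans hat) htb (by nlinarith)
  have hzero : agentCost (ray γ a') (M (ray β h) (ray γ b) (ray γ a')) = 0 := by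
    refine eq_zero_of_forall_exists_right (p := a) (b := b)
      (c := fun t => agentCost (ray γ t) (M (ray β h) (ray γ b) (ray γ t))) ?_ ?_ ?_ haa' hb1.le
    · intro t hat htb
      obtain ⟨s, h1, h2, h3, -, h5⟩ := key t hat htb
      refine ⟨s, h1, h2, h5, le_antisymm ?_ (agentCost_nonneg _ _)⟩
      simpa using hM.cost₃_le h3 (ray γ s)
    · intro r t har _ hat _ hr
      have := hM.cost₃_le (isFacility_of_agentCost_nonpos hr.le) (ray γ t)
      rwa [dist_ray_same γ (ha.trans hat) (ha.trans har)] at this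
    · obtain ⟨s, -, -, -, h4, h5⟩ := key a le_rfl (by linarith)
      have := hole b (by linarith) hb3
      simp only [h5]
      linarith
  obtain ⟨s, -, -, -, h4, h5⟩ := key a' haa' hb1.le
  have := hserved b hb1.le hb2
  linarith

/-- A step of length `h / (4 * ρ)` is short enough at every location, so finitely many steps reach
any `a`. -/
theorem IsNice.hasHole_of_hasHole_zero (hM : IsNice ρ M) (hβγ : β ≠ γ) (hh : 0 < h)
    (hole : HasHole ρ M h β γ 0) {a : ℝ} (ha : 0 ≤ a) : HasHole ρ M h β γ a := by
  have hρ := hM.one_le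
  have hσ : 0 < h / (4 * ρ) := by positivity
  have step : ∀ n : ℕ, ∀ a, 0 ≤ a → a ≤ n * (h / (4 * ρ)) → HasHole ρ M h β γ a := by
    intro n
    induction n with
    | zero =>
      intro a ha hn
      have : a = 0 := by simp at hn; linarith
      rwa [this]
    | succ n ih =>
      intro a ha hn
      push_cast at hn
      by_cases hle : a ≤ h / (4 * ρ)
      · refine hM.hasHole_of_hasHole_of_close hβγ hh le_rfl ha ?_ hole
        rw [le_div_iff₀ (by linarith)] at hle
        linarith
      · push Not at hle
        refine hM.hasHole_of_hasHole_of_close hβγ hh (sub_nonneg.2 hle.le) (by linarith) ?_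
          (ih (a - h / (4 * ρ)) (by linarith) (by linarith))
        have : 2 * ρ * (a - (a - h / (4 * ρ))) = h / 2 := by field_simp; ring
        linarith
  obtain ⟨n, hn⟩ := exists_nat_ge (a / (h / (4 * ρ)))
  exact step n a ha ((div_le_iff₀ hσ).1 hn)

/-- If the third agent has a hole at every location of the second agent on the branch `γ`, then the
second agent is served at locations on `γ` arbitrarily close to the center, provided that she is
served at some location on `γ`. -/
theorem IsNice.exists_served_lt (hM : IsNice ρ M) (hh : 0 < h)
    (hole : ∀ a, 0 ≤ a → HasHole ρ (swapAgents M) h β γ a) {v : S₃}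
    (hne : ∃ t, 0 < t ∧ agentCost (ray γ t) (M (ray β h) (ray γ t) v) = 0) {ε : ℝ} (hε : 0 < ε) :
    ∃ t, 0 < t ∧ t < ε ∧ agentCost (ray γ t) (M (ray β h) (ray γ t) v) = 0 := by
  have hρ := hM.one_le
  set Z : Set ℝ := {t | 0 < t ∧ agentCost (ray γ t) (M (ray β h) (ray γ t) v) = 0} with hZ
  have hZb : BddBelow Z := ⟨0, fun z hz => hz.1.le⟩
  set q := sInf Z with hq
  have hq0 : 0 ≤ q := le_csInf hne fun z hz => hz.1.le
  suffices hq0' : q = 0 by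
    obtain ⟨t, ⟨ht1, ht2⟩, ht3⟩ := exists_lt_of_csInf_lt hne (show sInf Z < ε by linarith)
    exact ⟨t, ht1, ht3, ht2⟩
  by_contra hqne
  have hqpos : 0 < q := lt_of_le_of_ne hq0 (Ne.symm hqne)
  obtain ⟨η, hη, hη1, hη2⟩ : ∃ η, 0 < η ∧ η ≤ q / 3 ∧ 2 * ρ * (2 * η) < h := by
    refine ⟨min (q / 3) (h / (8 * ρ)), lt_min (by positivity) (by positivity), min_le_left _ _, ?_⟩
    have hle := min_le_right (q / 3) (h / (8 * ρ))
    rw [le_div_iff₀ (by linarith)] at hle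
    linarith
  obtain ⟨t₀, ht₀, ht₀q⟩ := exists_lt_of_csInf_lt hne (show sInf Z < q + η by linarith)
  have hqt₀ : q ≤ t₀ := csInf_le hZb ht₀
  have hw0 : 0 ≤ q - η := by linarith
  -- From just below the infimum `q`, the second agent gets a facility at some served `t ≥ q`. A
  -- third agent located at `t` pays a positive cost by her hole, although reporting `v` would cost
  -- her nothing.
  have hcost := hM.cost₂_le (isFacility_of_agentCost_nonpos ht₀.2.le) (ray γ (q - η))
  rw [dist_ray_same γ hw0 ht₀.1.le, abs_of_nonpos (by linarith)] at hcost
  obtain ⟨y, hy, hye⟩ := exists_isFacility_agentCost_eq (ray γ (q - η))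
    (M (ray β h) (ray γ (q - η)) v)
  rw [hye] at hcost
  obtain ⟨t, ht, rfl, hd⟩ := eq_ray_of_dist_lt (show dist (ray γ (q - η)) y < q - η by linarith)
  have htZ : t ∈ Z := ⟨ht, le_antisymm (by simpa using hM.cost₂_le hy (ray γ t))
    (agentCost_nonneg _ _)⟩
  have hqt : q ≤ t := csInf_le hZb htZ
  rw [abs_of_nonpos (by linarith)] at hd
  have h3 : agentCost (ray γ t) (M (ray β h) (ray γ (q - η)) (ray γ t)) = t - (q - η) :=
    hole (q - η) hw0 t (by linarith) (by nlinarith)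
  have h4 := hM.cost₃_le hy (ray γ t)
  rw [dist_self] at h4
  linarith

/-- The third agent's holes push the served locations of the second agent towards the center, into
the second agent's own hole. -/
theorem IsNice.not_hasHole_both (hM : IsNice ρ M) (hβγ : β ≠ γ) (hh : 0 < h)
    (h₂ : HasHole ρ M h β γ 0) (h₃ : HasHole ρ (swapAgents M) h β γ 0) : False := by
  have hρ := hM.one_le
  have hR : 0 < ρ * h + 1 := by positivity
  have hε : 0 < h / (2 * ρ) := by positivity
  obtain ⟨t, ht, htε, hct⟩ := hM.exists_served_lt (v := ray γ 0) hh
    (fun a ha => hM.swap.hasHole_of_hasHole_zero hβγ hh h₃ ha) (by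
      -- At distance `ρ * h + 1` the cost bound `ρ * h` keeps the facility on `γ` and off the
      -- center.
      obtain ⟨y, hy, hye⟩ := exists_isFacility_agentCost_eq (ray γ (ρ * h + 1))
        (M (ray β h) (ray γ (ρ * h + 1)) (ray γ 0))
      have hb := hM.bound₁₃ (ray β h) (ray γ (ρ * h + 1)) (ray γ 0) (ray γ (ρ * h + 1)) (by simp)
      rw [hye, dist_ray_ne hβγ hh.le le_rfl, add_zero] at hb
      obtain ⟨t, ht, rfl, -⟩ := eq_ray_of_dist_lt
        (show dist (ray γ (ρ * h + 1)) y < ρ * h + 1 by linarith)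
      exact ⟨t, ht, le_antisymm (by simpa using hM.cost₂_le hy (ray γ t))
        (agentCost_nonneg _ _)⟩) hε
  rw [lt_div_iff₀ (by linarith)] at htε
  have := h₂ t ht.le (by linarith)
  linarith

/-- If the second agent would be served near the center on the branch `γ₁` and the third agent on
another branch `γ₂`, then the facility would follow the agent who is farther from the center, and
jump. -/
theorem IsNice.not_isServedNear_both (hM : IsNice ρ M) {γ₁ γ₂ : Fin 3} (hβ₁ : β ≠ γ₁)
    (hβ₂ : β ≠ γ₂) (h₁₂ : γ₁ ≠ γ₂) (hh : 0 < h) (h₂ : IsServedNear M h β γ₁ 0)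
    (h₃ : IsServedNear (swapAgents M) h β γ₂ 0) : False := by
  have hρ := hM.one_le
  obtain ⟨δ₁, hδ₁, H₁⟩ := h₂
  obtain ⟨δ₂, hδ₂, H₂⟩ := h₃
  obtain ⟨ε, hε, hε₁, hε₂, hεh⟩ : ∃ ε, 0 < ε ∧ 2 * ε ≤ δ₁ ∧ 2 * ε ≤ δ₂ ∧ 2 * ρ * (4 * ε) < h := by
    refine ⟨min (min (δ₁ / 2) (δ₂ / 2)) (h / (16 * ρ)), by positivity, ?_, ?_, ?_⟩
    · have := (min_le_left (min (δ₁ / 2) (δ₂ / 2)) (h / (16 * ρ))).trans (min_le_left _ _)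
      linarith
    · have := (min_le_left (min (δ₁ / 2) (δ₂ / 2)) (h / (16 * ρ))).trans (min_le_right _ _)
      linarith
    · have hle := min_le_right (min (δ₁ / 2) (δ₂ / 2)) (h / (16 * ρ))
      rw [le_div_iff₀ (by linarith)] at hle
      linarith
  -- the facility that serves both agents is the location of the one farther from the center
  have key : ∀ r s, 0 < r → r ≤ 2 * ε → 0 < s → s ≤ 2 * ε → r ≠ s →
      (r < s → agentCost (ray γ₁ r) (M (ray β h) (ray γ₁ r) (ray γ₂ s)) = r + s) ∧
      (s < r → IsFacility (ray γ₁ r) (M (ray β h) (ray γ₁ r) (ray γ₂ s))) := by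
    intro r s hr hrε hs hsε hrs
    have hd : dist (ray γ₁ r) (ray γ₂ s) = r + s := dist_ray_ne h₁₂ hr.le hs.le
    have hl : 2 * ρ * (r + s) < h := by nlinarith
    obtain ⟨y, hy, e1, e2, l1, l2⟩ := hM.exists_common_facility (a := ray β h) (b := ray γ₁ r)
      (c := ray γ₂ s) (by rw [hd, dist_ray_ne hβ₁ hh.le hr.le]; linarith)
      (by rw [hd, dist_ray_ne hβ₂ hh.le hs.le]; linarith)
    rw [hd] at l1 l2
    -- A third agent at the center pays `r`, so reporting `ray γ₂ s` must not bring her a nearer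
    -- facility.
    have hr0 : r ≤ dist (ray γ₁ 0) y := by
      obtain ⟨t, -, -, -, t2, t3⟩ := hM.exists_facility_mem_segment hβ₁ hh le_rfl hr.le
        (by nlinarith)
      have := H₁ r hr.le (by linarith)
      have h0 : agentCost (ray γ₁ 0) (M (ray β h) (ray γ₁ r) (ray γ₁ 0)) = r := by linarith
      rw [← h0]
      exact hM.cost₃_le hy _
    have hs0 : s ≤ dist (ray γ₂ 0) y := by
      obtain ⟨t, -, -, -, t2, t3⟩ := hM.swap.exists_facility_mem_segment hβ₂ hh le_rfl hs.le
        (by nlinarith)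
      have := H₂ s hs.le (by linarith)
      have h0 : agentCost (ray γ₂ 0) (M (ray β h) (ray γ₂ 0) (ray γ₂ s)) = s := by
        have : agentCost (ray γ₂ 0) (swapAgents M (ray β h) (ray γ₂ s) (ray γ₂ 0)) = s := by linarith
        exact this
      rw [← h0]
      exact hM.cost₂_le hy _
    obtain ⟨γ, t, ht, rfl⟩ := exists_ray y
    rw [ray_zero γ₁ γ, dist_ray_same γ le_rfl ht, zero_sub, abs_neg, abs_of_nonneg ht] at hr0
    rw [ray_zero γ₂ γ, dist_ray_same γ le_rfl ht, zero_sub, abs_neg, abs_of_nonneg ht] at hs0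
    by_cases hγ₂ : γ = γ₂
    · subst hγ₂
      rw [dist_ray_ne h₁₂ hr.le ht] at l1
      have hts : t = s := by linarith
      subst hts
      refine ⟨fun _ => ?_, fun hlt => by linarith⟩
      rw [e1, dist_ray_ne h₁₂ hr.le ht]
    · rw [dist_ray_ne (Ne.symm hγ₂) hs.le ht] at l2
      have htr : t = r := by linarith
      subst htr
      refine ⟨fun hlt => by linarith, fun hlt => ?_⟩
      by_cases hγ₁ : γ = γ₁
      · exact hγ₁ ▸ hy
      · rw [dist_ray_ne (Ne.symm hγ₁) hr.le ht] at l1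
        linarith
  -- At `3 / 4 * ε` the second agent pays `7 / 4 * ε`; reporting `5 / 4 * ε` would lower this to `ε
  -- / 2`.
  have k1 := (key (3 / 4 * ε) ε (by linarith) (by linarith) hε (by linarith) (by linarith)).1
    (by linarith)
  have k2 := (key (5 / 4 * ε) ε (by linarith) (by linarith) hε (by linarith) (by linarith)).2
    (by linarith)
  have k3 := hM.cost₂_le k2 (ray γ₁ (3 / 4 * ε))
  rw [k1, dist_ray_same γ₁ (by linarith) (by linarith), abs_of_nonpos (by linarith)] at k3
  linarith

/-- When the first agent is at distance `h` on the branch `β` and the other two agents are near the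
center, the second agent dictates the location of the facility that serves them. -/
def FavorsSecond (ρ : ℝ) (M : S₃ → S₃ → S₃ → S₃ × S₃) (h : ℝ) (β : Fin 3) : Prop :=
  ∀ γ, β ≠ γ → IsServedNear M h β γ 0 ∧ HasHole ρ (swapAgents M) h β γ 0

theorem IsServedNear.not_hasHole (hρ : 0 < ρ) (hh : 0 < h) (hs : IsServedNear M h β γ 0) :
    ¬ HasHole ρ M h β γ 0 := by
  rintro hole
  obtain ⟨δ, hδ, H⟩ := hs
  have hle := min_le_right δ (h / (4 * ρ))
  have hpos : 0 < min δ (h / (4 * ρ)) := by positivity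
  have h1 := H _ hpos.le (by linarith [min_le_left δ (h / (4 * ρ))])
  rw [le_div_iff₀ (by linarith)] at hle
  have h2 := hole _ hpos.le (by linarith)
  linarith

theorem FavorsSecond.not_swap (hρ : 0 < ρ) (hh : 0 < h) (h₁ : FavorsSecond ρ M h β)
    (h₂ : FavorsSecond ρ (swapAgents M) h β) : False := by
  obtain ⟨γ, hγ⟩ : ∃ γ, β ≠ γ := ⟨β + 1, by simp⟩
  exact (h₁ γ hγ).1.not_hasHole hρ hh (h₂ γ hγ).2

/-- If the second agent is served near the center on `γ₁`, the third is not on `γ₂` and so has a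
hole there. Then the second has none on `γ₂` and is served there, which gives the third a hole on
`γ₁` as well. -/
theorem IsNice.favorsSecond_or_swap (hM : IsNice ρ M) (hh : 0 < h) (β : Fin 3) :
    FavorsSecond ρ M h β ∨ FavorsSecond ρ (swapAgents M) h β := by
  have D₂ : ∀ γ, β ≠ γ → ¬ HasHole ρ M h β γ 0 → IsServedNear M h β γ 0 := fun γ hγ =>
    hM.isServedNear_of_not_hasHole hγ hh le_rfl
  have D₃ : ∀ γ, β ≠ γ → ¬ HasHole ρ (swapAgents M) h β γ 0 →
      IsServedNear (swapAgents M) h β γ 0 := fun γ hγ =>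
    hM.swap.isServedNear_of_not_hasHole hγ hh le_rfl
  have N : ∀ γ, β ≠ γ → ¬ (HasHole ρ M h β γ 0 ∧ HasHole ρ (swapAgents M) h β γ 0) :=
    fun γ hγ hN => hM.not_hasHole_both hγ hh hN.1 hN.2
  have S : ∀ γ₁ γ₂, β ≠ γ₁ → β ≠ γ₂ → γ₁ ≠ γ₂ →
      ¬ (IsServedNear M h β γ₁ 0 ∧ IsServedNear (swapAgents M) h β γ₂ 0) :=
    fun γ₁ γ₂ h1 h2 h12 hS => hM.not_isServedNear_both h1 h2 h12 hh hS.1 hS.2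
  obtain ⟨γ₁, γ₂, h1, h2, h12, hall⟩ : ∃ γ₁ γ₂, β ≠ γ₁ ∧ β ≠ γ₂ ∧ γ₁ ≠ γ₂ ∧
      ∀ γ, β ≠ γ → γ = γ₁ ∨ γ = γ₂ := ⟨β + 1, β + 2, by clear D₂ D₃ N S; decide +revert⟩
  have n1 := N γ₁ h1
  have n2 := N γ₂ h2
  have s12 := S γ₁ γ₂ h1 h2 h12
  have s21 := S γ₂ γ₁ h2 h1 h12.symm
  have a1 := D₂ γ₁ h1
  have a2 := D₂ γ₂ h2
  have b1 := D₃ γ₁ h1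
  have b2 := D₃ γ₂ h2
  have hss : swapAgents (swapAgents M) = M := rfl
  by_cases hc : IsServedNear M h β γ₁ 0
  · left
    intro γ hγ
    rcases hall γ hγ with rfl | rfl <;> tauto
  · right
    intro γ hγ
    rw [hss]
    rcases hall γ hγ with rfl | rfl <;> tauto

/-- With the second agent at the center and the others at `ray β h` and `ray γ c`, her dictatorship
over the third puts a facility at the center. If the first dictated over her, the two outer agents
would each need a further facility. -/
theorem IsNice.favorsSecond_rev (hM : IsNice ρ M) (hβγ : β ≠ γ) (hh : 0 < h) {c : ℝ}
    (hc : ρ * h < c) (hF : FavorsSecond ρ M h β) : FavorsSecond ρ (revAgents M) c γ := by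
  have hρ := hM.one_le
  have hc0 : 0 < c := lt_of_le_of_lt (by positivity) hc
  refine (hM.rev.favorsSecond_or_swap hc0 γ).resolve_right fun hG => ?_
  have hO : IsFacility (ray γ 0) (M (ray β h) (ray γ 0) (ray γ c)) := by
    refine isFacility_of_agentCost_nonpos (le_of_forall_pos_le_add fun ε hε => ?_)
    obtain ⟨t, ht, htε, hct⟩ := hM.exists_served_lt (v := ray γ c) hh
      (fun a ha => hM.swap.hasHole_of_hasHole_zero hβγ hh (hF γ hβγ).2 ha)
      ⟨c, hc0, agentCost_eq_zero (hM.isFacility_of_eq _ _)⟩ hε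
    have := hM.cost₂_le (isFacility_of_agentCost_nonpos hct.le) (ray γ 0)
    rw [dist_ray_same γ le_rfl ht.le, zero_sub, abs_neg, abs_of_pos ht] at this
    linarith
  -- By dictating, the first agent can obtain a facility on `β` off the center.
  have h1 : agentCost (ray β h) (M (ray β h) (ray γ 0) (ray γ c)) < h := by
    obtain ⟨δ, hδ, H⟩ := (hG β hβγ.symm).1
    have hpos : 0 < min δ h := lt_min hδ hh
    have h0 : agentCost (ray β (min δ h)) (M (ray β (min δ h)) (ray β 0) (ray γ c)) = 0 :=
      H _ hpos.le (by linarith [min_le_left δ h])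
    rw [ray_zero β γ] at h0
    have := hM.cost₁_le (isFacility_of_agentCost_nonpos h0.le) (ray β h)
    rw [dist_ray_same β hh.le hpos.le, abs_of_nonneg (by linarith [min_le_right δ h])] at this
    linarith
  have h3 : agentCost (ray γ c) (M (ray β h) (ray γ 0) (ray γ c)) < c := by
    have := hM.bound₁₂ (ray β h) (ray γ 0) (ray γ c) (ray γ c) (by simp)
    rw [dist_ray_ne hβγ hh.le le_rfl, add_zero] at this
    linarith
  obtain ⟨u, hu, hue⟩ := exists_isFacility_agentCost_eq (ray β h) (M (ray β h) (ray γ 0) (ray γ c))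
  obtain ⟨v, hv, hve⟩ := exists_isFacility_agentCost_eq (ray γ c) (M (ray β h) (ray γ 0) (ray γ c))
  rcases hO.eq_or_eq_or_eq hu hv with rfl | rfl | rfl
  · rw [hue, dist_ray_ne hβγ hh.le le_rfl] at h1
    linarith
  · rw [hve, dist_ray_same γ hc0.le le_rfl, sub_zero, abs_of_pos hc0] at h3
    linarith
  · have := dist_triangle_right (ray β h) (ray γ c) u
    rw [dist_ray_ne hβγ hh.le hc0.le] at this
    linarith

/-- The digits in the hypothesis names are the far agent, the dictator and the remaining agent. 123
gives 321; with the second agent far, 213 gives 312 and 231 gives 132, each a clash. The distances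
and branches are chosen so that clashing claims concern the same far location. -/
theorem IsNice.not_favorsSecond (hM : IsNice ρ M) : ¬ FavorsSecond ρ M 1 0 := by
  intro h123
  have hρ := hM.one_le
  have hρ0 : 0 < ρ := by linarith
  have hc : ρ * 1 < ρ + 1 := by linarith
  have hc' : ρ * (ρ + 1) < ρ * (ρ + 1) + 1 := by linarith
  have hc'' : ρ * 1 < ρ * (ρ + 1) + 1 := by nlinarith
  have h321 : FavorsSecond ρ (revAgents M) (ρ + 1) 1 :=
    hM.favorsSecond_rev (by decide) one_pos hc h123
  have h123' : FavorsSecond ρ M (ρ * (ρ + 1) + 1) 2 :=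
    hM.rev.favorsSecond_rev (by decide) (by linarith) hc' h321
  -- the second agent is far away
  have hN : IsNice ρ (revAgents (swapAgents (revAgents M))) := hM.rev.swap.rev
  rcases hN.favorsSecond_or_swap one_pos 0 with h213 | h231
  · have h312 : FavorsSecond ρ (swapAgents (revAgents M)) (ρ + 1) 1 :=
      hN.favorsSecond_rev (by decide) one_pos hc h213
    exact h321.not_swap hρ0 (by linarith) h312
  · have h132 : FavorsSecond ρ (swapAgents M) (ρ * (ρ + 1) + 1) 2 :=
      hN.swap.favorsSecond_rev (by decide) one_pos hc'' h231
    exact h123'.not_swap hρ0 (by nlinarith) h132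

theorem not_isNice : ¬ IsNice ρ M := fun hM =>
  (hM.favorsSecond_or_swap one_pos 0).elim hM.not_favorsSecond hM.swap.not_favorsSecond

end FarAgent

/-! ### Reduction to three agents -/

section Reduction

variable {n : ℕ} {X : Type*} [MetricSpace X]

/-- Agents at a common location do not gain by jointly moving to another common location. -/
theorem Mechanism.IsStrategyproof.cost_le_of_joint_move {F : Mechanism n X} (hF : F.IsStrategyproof)
    (p q : X) (x : Fin n → X) (s : Finset (Fin n)) (hx : ∀ i ∈ s, x i = p) :
    agentCost p (F x) ≤ agentCost p (F fun i => if i ∈ s then q else x i) := by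
  induction s using Finset.induction_on with
  | empty => simp
  | insert j s hj ih =>
    refine (ih fun i hi => hx i (Finset.mem_insert_of_mem hi)).trans ?_
    have h := hF (fun i => if i ∈ s then q else x i) j q
    simp only [hj, if_false, hx j (Finset.mem_insert_self _ _)] at h
    have e : (fun i => if i ∈ insert j s then q else x i) =
        Function.update (fun i => if i ∈ s then q else x i) j q := by
      funext i
      by_cases hij : i = j
      · subst hij; simp
      · simp [hij]
    rwa [e]

/-- The three-agent mechanism in which the third agent reports on behalf of all but two of the
`n` agents. -/
def Mechanism.merge (F : Mechanism n X) (a b c : X) : X × X :=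
  F fun i => if i.val = 0 then a else if i.val = 1 then b else c

theorem socialCost_nonneg (x : Fin n → X) (y : X × X) : 0 ≤ socialCost x y :=
  Finset.sum_nonneg fun i _ => agentCost_nonneg (x i) y

/-- Placing the facilities at all but one of the three locations costs each agent at most the
distance between the omitted location and a chosen one. Summing over the agents gives the factor
`n`. -/
theorem Mechanism.HasApproxRatio.isNice_merge {F : Mechanism n X} (hn : 3 ≤ n)
    (hF : F.IsStrategyproof) {ρ : ℝ} (hρ : F.HasApproxRatio ρ) : IsNice (ρ * n) F.merge := by
  have hn1 : (1 : ℝ) ≤ n := by exact_mod_cast (by omega : 1 ≤ n)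
  have bound : ∀ (a b c d : X) (y : X × X) (D : ℝ), agentCost a y ≤ D → agentCost b y ≤ D →
      agentCost c y ≤ D → d = a ∨ d = b ∨ d = c → agentCost d (F.merge a b c) ≤ ρ * n * D := by
    intro a b c d y D ha hb hc hd
    obtain ⟨x, hx⟩ : ∃ x : Fin n → X, x = fun i =>
      if i.val = 0 then a else if i.val = 1 then b else c := ⟨_, rfl⟩
    have hmem : ∃ i, x i = d := by
      rcases hd with rfl | rfl | rfl
      · exact ⟨⟨0, by omega⟩, by simp [hx]⟩
      · exact ⟨⟨1, by omega⟩, by simp [hx]⟩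
      · exact ⟨⟨2, by omega⟩, by simp [hx]⟩
    obtain ⟨i, hi⟩ := hmem
    have h1 : agentCost d (F x) ≤ socialCost x (F x) := by
      rw [← hi]
      exact Finset.single_le_sum (f := fun i => agentCost (x i) (F x))
        (fun i _ => agentCost_nonneg _ _) (Finset.mem_univ i)
    have h2 : optCost x ≤ socialCost x y :=
      ciInf_le ⟨0, by rintro _ ⟨y, rfl⟩; exact socialCost_nonneg x y⟩ y
    have h3 : socialCost x y ≤ n * D := by
      have := Finset.sum_le_card_nsmul Finset.univ (fun i => agentCost (x i) y) D (fun i _ => by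
        simp only [hx]; split_ifs <;> assumption)
      simpa [socialCost] using this
    have h4 := hρ.2 x
    have h5 := hρ.1
    have h6 : ρ * optCost x ≤ ρ * (n * D) := by gcongr; linarith
    change agentCost d (F fun i => if i.val = 0 then a else if i.val = 1 then b else c) ≤ _
    rw [← hx]
    linarith
  have fst_le : ∀ (a y z : X), agentCost a (y, z) ≤ dist a y := fun a y z => min_le_left _ _
  have snd_le : ∀ (a y z : X), agentCost a (y, z) ≤ dist a z := fun a y z => min_le_right _ _
  refine ⟨one_le_mul_of_one_le_of_one_le hρ.1 hn1, fun a b c a' => ?_, fun a b c b' => ?_,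
    fun a b c c' => ?_, fun a b c d hd => ?_, fun a b c d hd => ?_, fun a b c d hd => ?_⟩
  · have := hF.cost_le_of_joint_move a a'
      (fun i => if i.val = 0 then a else if i.val = 1 then b else c)
      (Finset.univ.filter fun i => i.val = 0) (by simp +contextual)
    refine this.trans (le_of_eq (congrArg (fun x => agentCost _ (F x)) (funext fun i => ?_)))
    simp only [Finset.mem_filter, Finset.mem_univ, true_and]
    split_ifs <;> rfl
  · have := hF.cost_le_of_joint_move b b'
      (fun i => if i.val = 0 then a else if i.val = 1 then b else c)
      (Finset.univ.filter fun i => i.val = 1) (by simp +contextual)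
    refine this.trans (le_of_eq (congrArg (fun x => agentCost _ (F x)) (funext fun i => ?_)))
    simp only [Finset.mem_filter, Finset.mem_univ, true_and]
    split_ifs <;> first | rfl | omega
  · have := hF.cost_le_of_joint_move c c'
      (fun i => if i.val = 0 then a else if i.val = 1 then b else c)
      (Finset.univ.filter fun i => i.val ≠ 0 ∧ i.val ≠ 1) (by simp +contextual)
    refine this.trans (le_of_eq (congrArg (fun x => agentCost _ (F x)) (funext fun i => ?_)))
    simp only [Finset.mem_filter, Finset.mem_univ, true_and]
    split_ifs <;> first | rfl | omega
  · refine bound a b c d (a, c) _ ((fst_le _ _ _).trans (by simp)) ?_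
      ((snd_le _ _ _).trans (by simp)) hd
    exact (fst_le _ _ _).trans (dist_comm a b).ge
  · refine bound a b c d (a, b) _ ((fst_le _ _ _).trans (by simp)) ((snd_le _ _ _).trans (by simp))
      ?_ hd
    exact (fst_le _ _ _).trans (dist_comm a c).ge
  · refine bound a b c d (a, b) _ ((fst_le _ _ _).trans (by simp)) ((snd_le _ _ _).trans (by simp))
      ?_ hd
    exact (snd_le _ _ _).trans (dist_comm b c).ge

end Reduction

end FacilityLocation

theorem mainTheorem8 (n : ℕ) (hn : 3 ≤ n)
    (F : FacilityLocation.Mechanism n FacilityLocation.S₃)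
    (hF : F.IsStrategyproof) : ¬ F.HasBoundedApproxRatio := by
  rintro ⟨ρ, hρ⟩
  exact FacilityLocation.not_isNice (hρ.isNice_merge hn hF)
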